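/- Let $D_T=\{x\in\mathbb{R}^2:\|x\|_T<1\}$ be the taxicab Poincaré disk, where $\|v\|_T=|v_1|+|v_2|$, with the norm $\|v\|_T/(1-\|x\|_T^2)$ on vectors $v$ based at $x\in D_T$. For $p,q\in D_T$ let $\Gamma(p,q)$ be the set of curves $\gamma:[0,1]\to D_T$ with absolutely continuous components, $\gamma(0)=p$ and $\gamma(1)=q$, and define the length of such a curve by $$\operatorname{len}(\gamma)=\int_0^1\frac{|\gamma_1'(t)|+|\gamma_2'(t)|}{1-(|\gamma_1(t)|+|\gamma_2(t)|)^2}\,dt.$$ Call $\gamma$ doubly monotonic if each of its two components is monotonic on $[0,1]$ (increasing or decreasing, not necessarily strictly). The minimal point of $p$ and $q$ is $m(p,q)=(\ell(p_1,q_1),\ell(p_2,q_2))$, where $\ell(x,y)=\operatorname{sgn}(x)\min\{|x|,|y|\}$ if $\operatorname{sgn}(x)=\operatorname{sgn}(y)$ and $\ell(x,y)=0$ otherwise, with $\operatorname{sgn}$ taking the values $1,-1,0$ on positive numbers, negative numbers and $0$. Let $\lambda_{p,q}:[0,1]\to D_T$ be the L-shaped curve that runs along the straight segment from $p$ to $m(p,q)$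 on $[0,\tfrac12]$ and along the straight segment from $m(p,q)$ to $q$ on $[\tfrac12,1]$, each at constant Euclidean speed. Theorem. For all $p,q\in D_T$ and all $\gamma\in\Gamma(p,q)$, $\operatorname{len}(\gamma)\ge\operatorname{len}(\lambda_{p,q})$, with equality if and only if $\gamma$ is doubly monotonic and passes through $m(p,q)$. -/

import Mathlib

namespace TaxicabHyp

open Set

/-- The taxicab norm on the plane. (Mathlib's norm on `ℝ × ℝ` is the sup norm, so it is not used.) -/
def taxiNorm (v : ℝ × ℝ) : ℝ := |v.1| + |v.2|

/-- The taxicab Poincaré disk. -/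
def disk : Set (ℝ × ℝ) := {x | taxiNorm x < 1}

/-- The norm of a vector `v` based at the point `x` of the disk. -/
noncomputable def hypNorm (x v : ℝ × ℝ) : ℝ := taxiNorm v / (1 - taxiNorm x ^ 2)

/-- The signed minimum: of the two arguments, the one closer to `0` if they have the same sign,
and `0` otherwise. Here `Real.sign` takes the values `1`, `-1`, `0`. -/
noncomputable def ell (x y : ℝ) : ℝ :=
  if Real.sign x = Real.sign y then Real.sign x * min |x| |y| else 0

/-- The minimal point associated to `p` and `q`. -/
noncomputable def minPoint (p q : ℝ × ℝ) : ℝ × ℝ := (ell p.1 q.1, ell p.2 q.2)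

/-- The set of curves in the disk from `p` to `q`: functions on `[0, 1]` with values in the disk and
absolutely continuous components, starting at `p` and ending at `q`. Curves are represented by
functions on `ℝ`, of which only the restriction to `[0, 1]` matters. -/
def curves (p q : ℝ × ℝ) : Set (ℝ → ℝ × ℝ) :=
  {γ | (∀ t ∈ Icc (0 : ℝ) 1, γ t ∈ disk) ∧
    AbsolutelyContinuousOnInterval (fun t => (γ t).1) 0 1 ∧
    AbsolutelyContinuousOnInterval (fun t => (γ t).2) 0 1 ∧
    γ 0 = p ∧ γ 1 = q}

/-- The length of a curve on `[0, 1]`. -/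
noncomputable def length (γ : ℝ → ℝ × ℝ) : ℝ :=
  ∫ t in (0 : ℝ)..1, hypNorm (γ t) (deriv (fun s => (γ s).1) t, deriv (fun s => (γ s).2) t)

/-- Both components are monotonic on `[0, 1]`, each one increasing or decreasing, not
necessarily strictly. -/
def DoublyMonotonic (γ : ℝ → ℝ × ℝ) : Prop :=
  (MonotoneOn (fun t => (γ t).1) (Icc 0 1) ∨ AntitoneOn (fun t => (γ t).1) (Icc 0 1)) ∧
  (MonotoneOn (fun t => (γ t).2) (Icc 0 1) ∨ AntitoneOn (fun t => (γ t).2) (Icc 0 1))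

/-- The curve `γ` passes through the point `x`. -/
def PassesThrough (γ : ℝ → ℝ × ℝ) (x : ℝ × ℝ) : Prop := ∃ t ∈ Icc (0 : ℝ) 1, γ t = x

/-- The concatenation of two curves on `[0, 1]`. -/
noncomputable def concat (γ φ : ℝ → ℝ × ℝ) : ℝ → ℝ × ℝ :=
  fun t => if t ≤ 1 / 2 then γ (2 * t) else φ (2 * t - 1)

/-- The segment from `p` to `q`. -/
def segmentCurve (p q : ℝ × ℝ) : ℝ → ℝ × ℝ :=
  fun t => (p.1 + t * (q.1 - p.1), p.2 + t * (q.2 - p.2))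

/-- The L-shaped curve from `p` to `q`, through their minimal point. -/
noncomputable def lCurve (p q : ℝ × ℝ) : ℝ → ℝ × ℝ :=
  concat (segmentCurve p (minPoint p q)) (segmentCurve (minPoint p q) q)

end TaxicabHyp

/-! The proof is a calibration argument. On the disk, `artanh ∘ taxiNorm` has derivative of norm one,
which gives the length of curves whose two components both approach `0`, or both move away from `0`.
For a fixed `p`, the candidate for the distance from `p` to `z` is
`artanh |p| + artanh |z| - 2 * artanh |m(p, z)|`, which is `potential p z` up to a constant. Along an
absolutely continuous curve `γ` from `p`, this function is absolutely continuous and its derivative is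
at most the speed of `γ` almost everywhere (`ae_potential`). This is an inequality for each component
separately (`component_le`): replacing `z` by its minimal point with `p` does not increase the norm, and
the derivative of `artanh` is increasing on `[0, 1)`. Integrating gives `potential_le_length`.

If equality holds, then the speed equals the derivative of the potential almost everywhere. This forces
each component to move away from its initial value, hence to be monotonic
(`monotoneOn_or_antitoneOn_of_deriv`), and forces `m(p, γ)` to move only while it coincides with `γ`.
At the first time at which `m(p, γ)` reaches `m(p, q)`, the curve therefore is at `m(p, q)`
(`passesThrough_of_length_eq`). Conversely, a doubly monotonic curve through `m(p, q)` approaches the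
origin in both components before this point and moves away from it afterwards, so that its length is the
lower bound (`length_eq`). The L-shaped curve is such a curve, so the lower bound is its length. -/

namespace TaxicabHyp

open Set MeasureTheory Filter Topology NNReal

/-! ### Absolutely continuous functions -/

/-- Only the values of `φ` on a set containing the range of `f` matter. This is needed for `artanh`,
which is Lipschitz on compact subsets of `(-1, 1)` only. -/
theorem absolutelyContinuousOnInterval_comp {φ f : ℝ → ℝ} {K : ℝ≥0} {s : Set ℝ} {a b : ℝ}
    (hφ : LipschitzOnWith K φ s) (hf : AbsolutelyContinuousOnInterval f a b)
    (hs : ∀ t ∈ uIcc a b, f t ∈ s) :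
    AbsolutelyContinuousOnInterval (fun t => φ (f t)) a b := by
  rw [absolutelyContinuousOnInterval_iff] at hf ⊢
  intro ε hε
  obtain ⟨δ, hδ, H⟩ := hf (ε / (K + 1)) (by positivity)
  refine ⟨δ, hδ, fun E hE hEδ => ?_⟩
  calc ∑ i ∈ Finset.range E.1, dist (φ (f (E.2 i).1)) (φ (f (E.2 i).2))
      ≤ ∑ i ∈ Finset.range E.1, K * dist (f (E.2 i).1) (f (E.2 i).2) := by
        refine Finset.sum_le_sum fun i hi => ?_
        exact hφ.dist_le_mul _ (hs _ (hE.1 i hi).1) _ (hs _ (hE.1 i hi).2)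
    _ = K * ∑ i ∈ Finset.range E.1, dist (f (E.2 i).1) (f (E.2 i).2) :=
        (Finset.mul_sum _ _ _).symm
    _ ≤ K * (ε / (K + 1)) := by gcongr; exact (H E hE hEδ).le
    _ < (K + 1) * (ε / (K + 1)) := by gcongr; linarith
    _ = ε := by field

theorem ae_differentiableAt_of_mem_Icc {f : ℝ → ℝ} (hf : AbsolutelyContinuousOnInterval f 0 1) :
    ∀ᵐ t, t ∈ Icc (0 : ℝ) 1 → DifferentiableAt ℝ f t := by
  simpa [uIcc_of_le (zero_le_one' ℝ)] using hf.ae_differentiableAt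

theorem monotoneOn_of_ae_deriv_nonneg {f : ℝ → ℝ} (hf : AbsolutelyContinuousOnInterval f 0 1)
    (h : ∀ᵐ t, t ∈ Icc (0 : ℝ) 1 → 0 ≤ deriv f t) : MonotoneOn f (Icc 0 1) := by
  intro s hs t ht hst
  have hsub : uIcc s t ⊆ uIcc 0 1 := by
    rw [uIcc_of_le hst, uIcc_of_le zero_le_one]
    exact Icc_subset_Icc hs.1 ht.2
  have := (hf.mono hsub).integral_deriv_eq_sub
  have h2 : 0 ≤ ∫ u in s..t, deriv f u := by
    refine intervalIntegral.integral_nonneg_of_ae_restrict hst ?_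
    filter_upwards [ae_restrict_of_ae h, ae_restrict_mem measurableSet_Icc] with u hu hu'
    exact hu ⟨hs.1.trans hu'.1, hu'.2.trans ht.2⟩
  linarith

/-! ### The signed minimum -/

/-- For `0 ≤ a`, the signed minimum `ell a` clamps its argument to `[0, a]`. -/
theorem ell_of_nonneg {a : ℝ} (ha : 0 ≤ a) (u : ℝ) : ell a u = max 0 (min u a) := by
  unfold ell
  rcases ha.eq_or_lt with rfl | ha
  · simp
  · rw [Real.sign_of_pos ha]
    rcases lt_trichotomy u 0 with hu | rfl | hu
    · rw [Real.sign_of_neg hu, if_neg (by norm_num), max_eq_left ((min_le_left _ _).trans hu.le)]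
    · simp [ha.le]
    · rw [Real.sign_of_pos hu, if_pos rfl, abs_of_pos ha, abs_of_pos hu, one_mul, min_comm,
        max_eq_right (le_min hu.le ha.le)]

theorem ell_neg (a u : ℝ) : ell (-a) (-u) = -ell a u := by
  unfold ell
  simp only [Real.sign_neg, neg_inj, abs_neg]
  split_ifs <;> simp

theorem ell_of_nonpos {a : ℝ} (ha : a ≤ 0) (u : ℝ) : ell a u = min 0 (max u a) := by
  have h := ell_of_nonneg (neg_nonneg.2 ha) (-u)
  rw [ell_neg] at h
  grind

theorem ell_self (a : ℝ) : ell a a = a := by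
  rcases le_total 0 a with h | h
  · simp [ell_of_nonneg h, h]
  · simp [ell_of_nonpos h, h]

theorem abs_ell_le_right (a u : ℝ) : |ell a u| ≤ |u| := by
  rcases le_total 0 a with h | h
  · rw [ell_of_nonneg h]; grind
  · rw [ell_of_nonpos h]; grind

theorem abs_ell_le_left (a u : ℝ) : |ell a u| ≤ |a| := by
  rcases le_total 0 a with h | h
  · rw [ell_of_nonneg h]; grind
  · rw [ell_of_nonpos h]; grind

theorem lipschitz_abs_ell (a : ℝ) : LipschitzWith 1 fun u => |ell a u| := by
  refine LipschitzWith.of_dist_le_mul fun u v => ?_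
  simp only [Real.dist_eq, NNReal.coe_one, one_mul]
  rcases le_total 0 a with h | h
  · simp only [ell_of_nonneg h]; grind
  · simp only [ell_of_nonpos h]; grind

/-- If the signed minimum does not shorten `u`, it does not change it. -/
theorem ell_eq_of_abs_eq {a u : ℝ} (h : |ell a u| = |u|) : ell a u = u := by
  rcases le_total 0 a with ha | ha
  · rw [ell_of_nonneg ha] at h ⊢; grind
  · rw [ell_of_nonpos ha] at h ⊢; grind

theorem absolutelyContinuousOnInterval_abs {x : ℝ → ℝ}
    (hx : AbsolutelyContinuousOnInterval x 0 1) :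
    AbsolutelyContinuousOnInterval (fun t => |x t|) 0 1 :=
  absolutelyContinuousOnInterval_comp (φ := fun u => |u|) (K := 1) (s := univ)
    (LipschitzWith.of_dist_le_mul fun u v => by
      simpa [Real.dist_eq] using abs_abs_sub_abs_le_abs_sub u v).lipschitzOnWith hx (by simp)

theorem absolutelyContinuousOnInterval_abs_ell (a : ℝ) {x : ℝ → ℝ}
    (hx : AbsolutelyContinuousOnInterval x 0 1) :
    AbsolutelyContinuousOnInterval (fun t => |ell a (x t)|) 0 1 :=
  absolutelyContinuousOnInterval_comp (φ := fun u => |ell a u|) (s := univ)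
    (lipschitz_abs_ell a).lipschitzOnWith hx
    (by simp)

/-! ### One component, at a point of differentiability -/

theorem deriv_abs_of_pos {x : ℝ → ℝ} {t : ℝ} (hx : DifferentiableAt ℝ x t) (h : 0 < x t) :
    deriv (fun s => |x s|) t = deriv x t := by
  refine EventuallyEq.deriv_eq ?_
  filter_upwards [hx.continuousAt.eventually_const_lt h] with s hs
  exact abs_of_pos hs

theorem deriv_abs_of_neg {x : ℝ → ℝ} {t : ℝ} (hx : DifferentiableAt ℝ x t) (h : x t < 0) :
    deriv (fun s => |x s|) t = -deriv x t := by
  simpa using deriv_abs_of_pos hx.neg (by simpa using h)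

/-- Since `|x|` has a minimum where `x` vanishes, its derivative there can only be zero, and hence so
is that of `x`. -/
theorem deriv_eq_zero_of_abs {x : ℝ → ℝ} {t : ℝ}
    (hN : DifferentiableAt ℝ (fun s => |x s|) t) (h0 : x t = 0) : deriv x t = 0 := by
  have h1 : deriv (fun s => |x s|) t = 0 :=
    IsLocalMin.deriv_eq_zero (Eventually.of_forall fun s => by simp [h0])
  have h2 := hN.hasDerivAt
  rw [h1, hasDerivAt_iff_isLittleO] at h2
  refine HasDerivAt.deriv ?_
  rw [hasDerivAt_iff_isLittleO]
  simpa [h0] using h2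

theorem abs_deriv_abs {x : ℝ → ℝ} {t : ℝ} (hx : DifferentiableAt ℝ x t)
    (hN : DifferentiableAt ℝ (fun s => |x s|) t) :
    |deriv (fun s => |x s|) t| = |deriv x t| := by
  rcases lt_trichotomy (x t) 0 with h | h | h
  · rw [deriv_abs_of_neg hx h]; simp
  · rw [deriv_eq_zero_of_abs hN h,
      IsLocalMin.deriv_eq_zero (Eventually.of_forall fun s => by simp [h])]
  · rw [deriv_abs_of_pos hx h]

/-- The contribution of one component `x` to the inequality between the speed of a curve and the
derivative of the potential along it, at a point where everything is differentiable. The weights `A ≤ B`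
stand for the derivatives of `artanh` at the norms of the minimal point and of the point itself.
For `0 ≤ a`, the derivative of `|ell a x|` is that of `x` if `0 < x < a` and zero otherwise. In case of
equality, the component moves away from `a`, in the weak sense, and `A = B` if it moves between
`0` and `a`. -/
theorem component_le {x : ℝ → ℝ} {a t A B : ℝ} (hx : DifferentiableAt ℝ x t)
    (hN : DifferentiableAt ℝ (fun s => |x s|) t)
    (hA : 0 < A) (hAB : A ≤ B) :
    B * deriv (fun s => |x s|) t - 2 * (A * deriv (fun s => |ell a (x s)|) t) ≤ B * |deriv x t| ∧
    (B * deriv (fun s => |x s|) t - 2 * (A * deriv (fun s => |ell a (x s)|) t) = B * |deriv x t| →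
      0 ≤ (x t - a) * deriv x t ∧ (deriv (fun s => |ell a (x s)|) t ≠ 0 → A = B)) := by
  wlog ha : 0 ≤ a generalizing x a
  · have := this (x := fun s => -x s) (a := -a) hx.neg (by simpa using hN) (by linarith)
    simp only [abs_neg, ell_neg, deriv.fun_neg] at this
    convert this using 4
    ring
  have hB : 0 < B := hA.trans_le hAB
  have hh : (fun s => |ell a (x s)|) = fun s => max 0 (min (x s) a) := by
    ext s; rw [ell_of_nonneg ha, abs_of_nonneg (le_max_left _ _)]
  rw [hh]
  have hmin : x t ≤ 0 → deriv (fun s => max 0 (min (x s) a)) t = 0 := fun h =>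
    IsLocalMin.deriv_eq_zero (Eventually.of_forall fun s => by
      simp [min_le_of_left_le h])
  have hmax : a ≤ x t → deriv (fun s => max 0 (min (x s) a)) t = 0 := fun h =>
    IsLocalMax.deriv_eq_zero (Eventually.of_forall fun s => by
      simp [h, ha])
  rcases lt_trichotomy (x t) 0 with h | h | h
  · rw [deriv_abs_of_neg hx h, hmin h.le]
    refine ⟨by nlinarith [neg_le_abs (deriv x t)], fun he => ⟨?_, fun h => absurd rfl h⟩⟩
    have : -deriv x t = |deriv x t| := mul_left_cancel₀ hB.ne' (by linarith)
    nlinarith [abs_nonneg (deriv x t)]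
  · rw [deriv_eq_zero_of_abs hN h, hmin h.le,
      IsLocalMin.deriv_eq_zero (Eventually.of_forall fun s => by simp [h])]
    simp
  · rw [deriv_abs_of_pos hx h]
    rcases lt_or_ge (x t) a with h1 | h1
    · have : (fun s => max 0 (min (x s) a)) =ᶠ[𝓝 t] x := by
        filter_upwards [hx.continuousAt.eventually_lt_const h1,
          hx.continuousAt.eventually_const_lt h] with s hs1 hs2
        rw [min_eq_left hs1.le, max_eq_right hs2.le]
      rw [this.deriv_eq]
      set d := deriv x t
      rcases le_or_gt d 0 with hd | hd
      · rw [abs_of_nonpos hd]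
        refine ⟨by nlinarith, fun he => ⟨by nlinarith, fun hd0 => ?_⟩⟩
        exact mul_right_cancel₀ hd0 (by linarith)
      · rw [abs_of_pos hd]
        exact ⟨by nlinarith, fun he => by nlinarith⟩
    · rw [hmax h1]
      refine ⟨by nlinarith [le_abs_self (deriv x t)], fun he => ⟨?_, fun h => absurd rfl h⟩⟩
      have : deriv x t = |deriv x t| := mul_left_cancel₀ hB.ne' (by linarith)
      nlinarith [abs_nonneg (deriv x t)]

/-- A function which almost everywhere moves away from its initial value, in the weak sense, is
monotone or antitone: the square of its distance to the initial value is monotone, so once it has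
left the initial value it cannot return to it and cross to the other side. -/
theorem monotoneOn_or_antitoneOn_of_deriv {x : ℝ → ℝ} (hx : AbsolutelyContinuousOnInterval x 0 1)
    (h : ∀ᵐ t, t ∈ Icc (0 : ℝ) 1 → 0 ≤ (x t - x 0) * deriv x t) :
    MonotoneOn x (Icc 0 1) ∨ AntitoneOn x (Icc 0 1) := by
  wlog h1 : x 0 ≤ x 1 generalizing x
  · have := this (x := fun t => -x t) hx.neg (by
      filter_upwards [h] with t ht ht'
      rw [deriv.fun_neg]
      linarith [ht ht']) (by linarith)
    refine this.symm.imp (fun H => ?_) fun H => ?_ <;> simpa using H.neg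
  have hc : ContinuousOn x (Icc 0 1) := by
    simpa [uIcc_of_le (zero_le_one' ℝ)] using hx.continuousOn
  have hac : AbsolutelyContinuousOnInterval (fun t => x t - x 0) 0 1 :=
    hx.sub (g := fun _ => x 0)
      (LipschitzWith.const (x 0)).lipschitzOnWith.absolutelyContinuousOnInterval
  have hmono : MonotoneOn (fun t => (x t - x 0) * (x t - x 0)) (Icc 0 1) := by
    refine monotoneOn_of_ae_deriv_nonneg (hac.mul hac) ?_
    filter_upwards [h, ae_differentiableAt_of_mem_Icc hx] with t ht hd ht'
    have := (hd ht').hasDerivAt.sub_const (x 0)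
    rw [(this.fun_mul this).deriv]
    linarith [ht ht']
  have hge : ∀ t ∈ Icc (0 : ℝ) 1, x 0 ≤ x t := by
    intro t ht
    by_contra! hlt
    obtain ⟨s, hs, hsx⟩ := intermediate_value_Icc ht.2 (hc.mono (Icc_subset_Icc_left ht.1))
      ⟨hlt.le, h1⟩
    have : (x t - x 0) * (x t - x 0) ≤ (x s - x 0) * (x s - x 0) :=
      hmono ht ⟨ht.1.trans hs.1, hs.2⟩ hs.1
    rw [hsx] at this
    nlinarith
  left
  intro s hs t ht hst
  have : (x s - x 0) * (x s - x 0) ≤ (x t - x 0) * (x t - x 0) := hmono hs ht hst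
  nlinarith [hge s hs, hge t ht]

/-! ### The potential -/

theorem hasDerivAt_artanh {s : ℝ} (h0 : -1 < s) (h1 : s < 1) :
    HasDerivAt Real.artanh (1 / (1 - s ^ 2)) s := by
  have h : HasDerivAt (fun s => 1 / 2 * Real.log ((1 + s) / (1 - s)))
      (1 / (1 - s ^ 2)) s := by
    have ha : (1 - s) ≠ 0 := by linarith
    have hb : (1 + s) ≠ 0 := by linarith
    have h2 : 1 - s ^ 2 ≠ 0 := by
      rw [show 1 - s ^ 2 = (1 - s) * (1 + s) by ring]; exact mul_ne_zero ha hb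
    refine (((((hasDerivAt_id' s).const_add 1).fun_div ((hasDerivAt_id' s).const_sub 1) ha).log
      (div_ne_zero hb ha)).const_mul (1 / 2)).congr_deriv ?_
    field_simp
    ring
  refine h.congr_of_eventuallyEq ?_
  filter_upwards [Ioo_mem_nhds h0 h1] with u hu
  exact Real.artanh_eq_half_log ⟨hu.1.le, hu.2.le⟩

theorem hasDerivAt_artanh_comp {f : ℝ → ℝ} {f' t : ℝ} (hf : HasDerivAt f f' t)
    (h0 : 0 ≤ f t) (h1 : f t < 1) :
    HasDerivAt (fun s => Real.artanh (f s)) (1 / (1 - f t ^ 2) * f') t :=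
  HasDerivAt.comp (h₂ := Real.artanh) t (hasDerivAt_artanh (by linarith) h1) hf

theorem absolutelyContinuousOnInterval_artanh {f : ℝ → ℝ}
    (hf : AbsolutelyContinuousOnInterval f 0 1)
    (h0 : ∀ t ∈ Icc (0 : ℝ) 1, 0 ≤ f t) (h1 : ∀ t ∈ Icc (0 : ℝ) 1, f t < 1) :
    AbsolutelyContinuousOnInterval (fun t => Real.artanh (f t)) 0 1 := by
  have hI := uIcc_of_le (zero_le_one' ℝ)
  have hc : ContinuousOn f (Icc 0 1) := by simpa [hI] using hf.continuousOn
  obtain ⟨m, hm, hmax⟩ := isCompact_Icc.exists_isMaxOn (nonempty_Icc.2 zero_le_one) hc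
  have hL : LipschitzOnWith (Real.toNNReal (1 / (1 - f m ^ 2))) Real.artanh (Icc 0 (f m)) := by
    refine (convex_Icc _ _).lipschitzOnWith_of_nnnorm_hasDerivWithin_le
      (f' := fun s => 1 / (1 - s ^ 2))
      (fun s hs => (hasDerivAt_artanh (by linarith [hs.1]) (hs.2.trans_lt (h1 m hm))
        ).hasDerivWithinAt) fun s hs => ?_
    have h3 : 0 < 1 - f m ^ 2 := by nlinarith [h0 m hm, h1 m hm]
    have h4 : 1 - f m ^ 2 ≤ 1 - s ^ 2 := by nlinarith [hs.1, hs.2]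
    rw [← NNReal.coe_le_coe, Real.coe_toNNReal _ (by positivity), coe_nnnorm, Real.norm_eq_abs,
      abs_of_nonneg (one_div_nonneg.2 (h3.le.trans h4))]
    exact one_div_le_one_div_of_le h3 h4
  refine absolutelyContinuousOnInterval_comp hL hf fun t ht => ?_
  rw [hI] at ht
  exact ⟨h0 t ht, hmax ht⟩

/-! ### The length of a curve -/

/-- The integrand of `length`: the speed of `γ` at the time `t` in the metric of the disk. -/
noncomputable def speed (γ : ℝ → ℝ × ℝ) (t : ℝ) : ℝ :=
  hypNorm (γ t) (deriv (fun s => (γ s).1) t, deriv (fun s => (γ s).2) t)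

/-- The distance from `p` to `z`, up to the additive constant `artanh (taxiNorm p)`. It is defined by
the explicit formula that the L-shaped curve suggests: one first moves towards the origin from `p` to
the minimal point, then away from it to `z`. -/
noncomputable def potential (p z : ℝ × ℝ) : ℝ :=
  Real.artanh (taxiNorm z) - 2 * Real.artanh (taxiNorm (minPoint p z))

theorem taxiNorm_nonneg (v : ℝ × ℝ) : 0 ≤ taxiNorm v := by unfold taxiNorm; positivity

theorem taxiNorm_minPoint_le_right (p z : ℝ × ℝ) : taxiNorm (minPoint p z) ≤ taxiNorm z :=
  add_le_add (abs_ell_le_right _ _) (abs_ell_le_right _ _)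

theorem minPoint_self (p : ℝ × ℝ) : minPoint p p = p := by
  simp [minPoint, ell_self]

theorem minPoint_eq_of_taxiNorm_eq {p z : ℝ × ℝ}
    (h : taxiNorm (minPoint p z) = taxiNorm z) : minPoint p z = z := by
  have h1 := abs_ell_le_right p.1 z.1
  have h2 := abs_ell_le_right p.2 z.2
  simp only [taxiNorm, minPoint] at h
  exact Prod.ext (ell_eq_of_abs_eq (by linarith)) (ell_eq_of_abs_eq (by linarith))

section Curve

variable {p q : ℝ × ℝ} {γ : ℝ → ℝ × ℝ}

theorem absolutelyContinuousOnInterval_taxiNorm (hγ : γ ∈ curves p q) :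
    AbsolutelyContinuousOnInterval (fun t => taxiNorm (γ t)) 0 1 :=
  (absolutelyContinuousOnInterval_abs hγ.2.1).add
  (absolutelyContinuousOnInterval_abs hγ.2.2.1)

theorem absolutelyContinuousOnInterval_minPoint (hγ : γ ∈ curves p q) (r : ℝ × ℝ) :
    AbsolutelyContinuousOnInterval (fun t => taxiNorm (minPoint r (γ t))) 0 1 :=
  (absolutelyContinuousOnInterval_abs_ell r.1 hγ.2.1).add
  (absolutelyContinuousOnInterval_abs_ell r.2 hγ.2.2.1)

theorem absolutelyContinuousOnInterval_artanh_taxiNorm (hγ : γ ∈ curves p q) :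
    AbsolutelyContinuousOnInterval (fun t => Real.artanh (taxiNorm (γ t))) 0 1 :=
  absolutelyContinuousOnInterval_artanh (absolutelyContinuousOnInterval_taxiNorm hγ)
    (fun _ _ => taxiNorm_nonneg _) hγ.1

theorem absolutelyContinuousOnInterval_potential (hγ : γ ∈ curves p q) (r : ℝ × ℝ) :
    AbsolutelyContinuousOnInterval (fun t => potential r (γ t)) 0 1 :=
  (absolutelyContinuousOnInterval_artanh_taxiNorm hγ).sub
  ((absolutelyContinuousOnInterval_artanh (absolutelyContinuousOnInterval_minPoint hγ r)
    (fun _ _ => taxiNorm_nonneg _)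
    (fun t ht => (taxiNorm_minPoint_le_right _ _).trans_lt (hγ.1 t ht))).const_mul 2)

theorem intervalIntegrable_speed (hγ : γ ∈ curves p q) :
    IntervalIntegrable (speed γ) volume 0 1 := by
  have hI := uIcc_of_le (zero_le_one' ℝ)
  have hN := (absolutelyContinuousOnInterval_taxiNorm hγ).continuousOn
  have : speed γ = fun t => (|deriv (fun s => (γ s).1) t| + |deriv (fun s => (γ s).2) t|) *
      (1 - taxiNorm (γ t) ^ 2)⁻¹ := by
    ext t; rw [speed, hypNorm, div_eq_mul_inv]; rfl
  rw [this]
  refine IntervalIntegrable.mul_continuousOn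
    (hγ.2.1.intervalIntegrable_deriv.abs.add hγ.2.2.1.intervalIntegrable_deriv.abs) ?_
  refine ContinuousOn.inv₀ (continuousOn_const.sub (hN.pow 2)) fun t ht => ?_
  rw [hI] at ht
  have h1 : taxiNorm (γ t) < 1 := hγ.1 t ht
  nlinarith [taxiNorm_nonneg (γ t)]

theorem ae_differentiableAt_taxiNorm (hγ : γ ∈ curves p q) :
    ∀ᵐ t, t ∈ Icc (0 : ℝ) 1 →
      (DifferentiableAt ℝ (fun s => (γ s).1) t ∧ DifferentiableAt ℝ (fun s => |(γ s).1|) t) ∧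
      (DifferentiableAt ℝ (fun s => (γ s).2) t ∧ DifferentiableAt ℝ (fun s => |(γ s).2|) t) := by
  filter_upwards [ae_differentiableAt_of_mem_Icc hγ.2.1,
    ae_differentiableAt_of_mem_Icc hγ.2.2.1,
    ae_differentiableAt_of_mem_Icc (absolutelyContinuousOnInterval_abs hγ.2.1),
    ae_differentiableAt_of_mem_Icc (absolutelyContinuousOnInterval_abs hγ.2.2.1)]
    with t h1 h2 h3 h4 ht
  exact ⟨⟨h1 ht, h3 ht⟩, ⟨h2 ht, h4 ht⟩⟩

theorem ae_hasDerivAt_artanh_taxiNorm (hγ : γ ∈ curves p q) :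
    ∀ᵐ t, t ∈ Icc (0 : ℝ) 1 → HasDerivAt (fun s => Real.artanh (taxiNorm (γ s)))
      (1 / (1 - taxiNorm (γ t) ^ 2) *
        (deriv (fun s => |(γ s).1|) t + deriv (fun s => |(γ s).2|) t)) t := by
  filter_upwards [ae_differentiableAt_taxiNorm hγ] with t h ht
  obtain ⟨⟨-, h1⟩, ⟨-, h2⟩⟩ := h ht
  exact hasDerivAt_artanh_comp (f := fun s => taxiNorm (γ s)) (h1.hasDerivAt.add h2.hasDerivAt)
    (taxiNorm_nonneg _) (hγ.1 t ht)

/-- The potential grows at most at the speed of the curve. If it grows exactly at that speed, both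
components move away from those of `p`, and the minimal point of `p` and the current point can only
move while it coincides with the current point. -/
theorem ae_potential (hγ : γ ∈ curves p q) :
    ∀ᵐ t, t ∈ Icc (0 : ℝ) 1 → deriv (fun s => potential p (γ s)) t ≤ speed γ t ∧
      (deriv (fun s => potential p (γ s)) t = speed γ t →
        0 ≤ ((γ t).1 - p.1) * deriv (fun s => (γ s).1) t ∧
        0 ≤ ((γ t).2 - p.2) * deriv (fun s => (γ s).2) t ∧
        (deriv (fun s => taxiNorm (minPoint p (γ s))) t ≠ 0 → minPoint p (γ t) = γ t)) := by
  filter_upwards [ae_differentiableAt_taxiNorm hγ, ae_hasDerivAt_artanh_taxiNorm hγ,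
    ae_differentiableAt_of_mem_Icc (absolutelyContinuousOnInterval_abs_ell p.1 hγ.2.1),
    ae_differentiableAt_of_mem_Icc (absolutelyContinuousOnInterval_abs_ell p.2 hγ.2.2.1)]
    with t h hN hm1 hm2 ht
  obtain ⟨⟨hx, hxa⟩, ⟨hy, hya⟩⟩ := h ht
  have hM : HasDerivAt (fun s => taxiNorm (minPoint p (γ s)))
      (deriv (fun s => |ell p.1 (γ s).1|) t + deriv (fun s => |ell p.2 (γ s).2|) t) t :=
    (hm1 ht).hasDerivAt.add (hm2 ht).hasDerivAt
  have h1 : taxiNorm (γ t) < 1 := hγ.1 t ht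
  have hle := taxiNorm_minPoint_le_right p (γ t)
  have h0 := taxiNorm_nonneg (minPoint p (γ t))
  have hP : HasDerivAt (fun s => potential p (γ s)) _ t := (hN ht).sub
    ((hasDerivAt_artanh_comp hM h0 (hle.trans_lt h1)).const_mul 2)
  have hA : 0 < 1 / (1 - taxiNorm (minPoint p (γ t)) ^ 2) := by
    apply one_div_pos.2; nlinarith
  have hpos : 0 < 1 - taxiNorm (γ t) ^ 2 := by nlinarith
  have hAB : 1 / (1 - taxiNorm (minPoint p (γ t)) ^ 2) ≤ 1 / (1 - taxiNorm (γ t) ^ 2) :=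
    one_div_le_one_div_of_le hpos (by nlinarith)
  have hs : speed γ t = 1 / (1 - taxiNorm (γ t) ^ 2) * |deriv (fun s => (γ s).1) t| +
      1 / (1 - taxiNorm (γ t) ^ 2) * |deriv (fun s => (γ s).2) t| := by
    rw [speed, hypNorm, taxiNorm]; ring
  have heq : 1 / (1 - taxiNorm (minPoint p (γ t)) ^ 2) = 1 / (1 - taxiNorm (γ t) ^ 2) →
      minPoint p (γ t) = γ t := fun h => by
    refine minPoint_eq_of_taxiNorm_eq ?_
    rw [one_div, one_div, inv_inj] at h
    nlinarith
  obtain ⟨l1, e1⟩ := component_le (a := p.1) hx hxa hA hAB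
  obtain ⟨l2, e2⟩ := component_le (a := p.2) hy hya hA hAB
  rw [hP.deriv, hM.deriv, hs]
  refine ⟨by linarith, fun he => ?_⟩
  obtain ⟨m1, n1⟩ := e1 (by linarith)
  obtain ⟨m2, n2⟩ := e2 (by linarith)
  refine ⟨m1, m2, fun hne => heq ?_⟩
  by_contra hc
  exact hne (by rw [not_not.1 (mt n1 hc), not_not.1 (mt n2 hc), add_zero])

theorem integral_deriv_potential (hγ : γ ∈ curves p q) :
    ∫ t in (0 : ℝ)..1, deriv (fun s => potential p (γ s)) t =
      potential p q + Real.artanh (taxiNorm p) := by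
  rw [(absolutelyContinuousOnInterval_potential hγ p).integral_deriv_eq_sub, hγ.2.2.2.1,
    hγ.2.2.2.2, potential, potential, minPoint_self]
  ring

theorem potential_le_length (hγ : γ ∈ curves p q) :
    potential p q + Real.artanh (taxiNorm p) ≤ length γ := by
  rw [← integral_deriv_potential hγ]
  refine intervalIntegral.integral_mono_ae_restrict zero_le_one
    (absolutelyContinuousOnInterval_potential hγ p).intervalIntegrable_deriv
    (intervalIntegrable_speed hγ) ?_
  filter_upwards [ae_restrict_of_ae (ae_potential hγ), ae_restrict_mem measurableSet_Icc]
    with t h ht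
  exact (h ht).1

theorem ae_deriv_potential_eq_speed (hγ : γ ∈ curves p q)
    (h : length γ = potential p q + Real.artanh (taxiNorm p)) :
    ∀ᵐ t, t ∈ Icc (0 : ℝ) 1 → deriv (fun s => potential p (γ s)) t = speed γ t := by
  have hi := (absolutelyContinuousOnInterval_potential hγ p).intervalIntegrable_deriv
  have h0 : ∫ t in (0 : ℝ)..1, (speed γ t - deriv (fun s => potential p (γ s)) t) = 0 := by
    rw [intervalIntegral.integral_sub (intervalIntegrable_speed hγ) hi,
      integral_deriv_potential hγ, ← h]
    exact sub_self (length γ)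
  rw [intervalIntegral.integral_eq_zero_iff_of_le_of_nonneg_ae zero_le_one ?_
    ((intervalIntegrable_speed hγ).sub hi)] at h0
  · rw [restrict_Ioc_eq_restrict_Icc, EventuallyEq, ae_restrict_iff' measurableSet_Icc] at h0
    filter_upwards [h0] with t h1 ht
    exact (sub_eq_zero.1 (h1 ht)).symm
  · filter_upwards [ae_restrict_of_ae (ae_potential hγ), ae_restrict_mem measurableSet_Ioc]
      with t h ht
    exact sub_nonneg.2 (h (Ioc_subset_Icc_self ht)).1

theorem doublyMonotonic_of_length_eq (hγ : γ ∈ curves p q)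
    (h : length γ = potential p q + Real.artanh (taxiNorm p)) : DoublyMonotonic γ := by
  have hd := ae_deriv_potential_eq_speed hγ h
  constructor
  · refine monotoneOn_or_antitoneOn_of_deriv hγ.2.1 ?_
    filter_upwards [hd, ae_potential hγ] with t h1 h2 ht
    rw [hγ.2.2.2.1]
    exact ((h2 ht).2 (h1 ht)).1
  · refine monotoneOn_or_antitoneOn_of_deriv hγ.2.2.1 ?_
    filter_upwards [hd, ae_potential hγ] with t h1 h2 ht
    rw [hγ.2.2.2.1]
    exact ((h2 ht).2 (h1 ht)).2.1

end Curve

/-! ### Curves of minimal length pass through the minimal point -/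

/-- The minimal point of the initial and the current point of a doubly monotonic curve can only move
towards the origin. -/
theorem antitoneOn_abs_ell {x : ℝ → ℝ}
    (h : MonotoneOn x (Icc 0 1) ∨ AntitoneOn x (Icc 0 1)) :
    AntitoneOn (fun t => |ell (x 0) (x t)|) (Icc 0 1) := by
  intro s hs t ht hst
  have h0 : (0 : ℝ) ∈ Icc (0 : ℝ) 1 := by simp
  rcases le_total 0 (x 0) with ha | ha
  · simp only [ell_of_nonneg ha]
    rcases h with h | h
    · have := h h0 hs hs.1; have := h hs ht hst; grind
    · have := h h0 hs hs.1; have := h hs ht hst; grind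
  · simp only [ell_of_nonpos ha]
    rcases h with h | h
    · have := h h0 hs hs.1; have := h hs ht hst; grind
    · have := h h0 hs hs.1; have := h hs ht hst; grind

theorem ell_congr_of_abs_eq {a u v : ℝ} (h : |ell a u| = |ell a v|) : ell a u = ell a v := by
  rcases le_total 0 a with ha | ha
  · rw [ell_of_nonneg ha, ell_of_nonneg ha] at h ⊢
    rwa [abs_of_nonneg (le_max_left _ _), abs_of_nonneg (le_max_left _ _)] at h
  · rw [ell_of_nonpos ha, ell_of_nonpos ha] at h ⊢
    rwa [abs_of_nonpos (min_le_left _ _), abs_of_nonpos (min_le_left _ _), neg_inj] at h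

/-- A monotonic component that takes the signed minimum of its end values at the time `T` approaches
`0` before `T` and moves away from `0` after `T`. -/
theorem abs_antitoneOn_monotoneOn {x : ℝ → ℝ} {T : ℝ}
    (h : MonotoneOn x (Icc 0 1) ∨ AntitoneOn x (Icc 0 1)) (hT : T ∈ Icc (0 : ℝ) 1)
    (hm : x T = ell (x 0) (x 1)) :
    AntitoneOn (fun t => |x t|) (Icc 0 T) ∧ MonotoneOn (fun t => |x t|) (Icc T 1) := by
  have h0 : (0 : ℝ) ∈ Icc (0 : ℝ) 1 := by simp
  have h1 : (1 : ℝ) ∈ Icc (0 : ℝ) 1 := by simp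
  have hm' : x T = max 0 (min (x 1) (x 0)) ∧ 0 ≤ x 0 ∨
      x T = min 0 (max (x 1) (x 0)) ∧ x 0 ≤ 0 := by
    rcases le_total 0 (x 0) with ha | ha
    · left; exact ⟨by rw [hm, ell_of_nonneg ha], ha⟩
    · right; exact ⟨by rw [hm, ell_of_nonpos ha], ha⟩
  constructor
  · intro s hs t ht hst
    have hs' : s ∈ Icc (0 : ℝ) 1 := ⟨hs.1, hs.2.trans hT.2⟩
    have ht' : t ∈ Icc (0 : ℝ) 1 := ⟨ht.1, ht.2.trans hT.2⟩
    simp only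
    rcases h with h | h
    · have := h h0 hs' hs.1; have := h hs' ht' hst; have := h ht' hT ht.2
      have := h hT h1 hT.2
      rcases hm' with ⟨e, _⟩ | ⟨e, _⟩ <;> grind
    · have := h h0 hs' hs.1; have := h hs' ht' hst; have := h ht' hT ht.2
      have := h hT h1 hT.2
      rcases hm' with ⟨e, _⟩ | ⟨e, _⟩ <;> grind
  · intro s hs t ht hst
    have hs' : s ∈ Icc (0 : ℝ) 1 := ⟨hT.1.trans hs.1, hs.2⟩
    have ht' : t ∈ Icc (0 : ℝ) 1 := ⟨hT.1.trans ht.1, ht.2⟩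
    simp only
    rcases h with h | h
    · have := h hT hs' hs.1; have := h hs' ht' hst; have := h ht' h1 ht.2
      have := h h0 hT hT.1
      rcases hm' with ⟨e, _⟩ | ⟨e, _⟩ <;> grind
    · have := h hT hs' hs.1; have := h hs' ht' hst; have := h ht' h1 ht.2
      have := h h0 hT hT.1
      rcases hm' with ⟨e, _⟩ | ⟨e, _⟩ <;> grind

section Curve

variable {p q : ℝ × ℝ} {γ : ℝ → ℝ × ℝ}

/-- When the minimal point of `p` and the current point first reaches `minPoint p q`, it has been moving
immediately before (unless the time is `0`), hence it coincides with the current point. -/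
theorem passesThrough_of_length_eq (hγ : γ ∈ curves p q)
    (h : length γ = potential p q + Real.artanh (taxiNorm p)) :
    PassesThrough γ (minPoint p q) := by
  obtain ⟨hmx, hmy⟩ := doublyMonotonic_of_length_eq hγ h
  have hax := antitoneOn_abs_ell hmx
  have hay := antitoneOn_abs_ell hmy
  simp only [hγ.2.2.2.1] at hax hay
  have hI := uIcc_of_le (zero_le_one' ℝ)
  have h1 : (1 : ℝ) ∈ Icc (0 : ℝ) 1 := by simp
  have hac := absolutelyContinuousOnInterval_minPoint hγ p
  set M : ℝ → ℝ := fun t => taxiNorm (minPoint p (γ t)) with hM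
  have hcM : ContinuousOn M (Icc 0 1) := by simpa [hI] using hac.continuousOn
  have hcN : ContinuousOn (fun t => taxiNorm (γ t)) (Icc 0 1) := by
    simpa [hI] using (absolutelyContinuousOnInterval_taxiNorm hγ).continuousOn
  -- The first time at which the minimal point with `p` has reached `minPoint p q`.
  obtain ⟨T, ⟨hT, hMT⟩, hleast⟩ : ∃ T, IsLeast (Icc (0 : ℝ) 1 ∩ M ⁻¹' {M 1}) T :=
    (isCompact_Icc.of_isClosed_subset (hcM.preimage_isClosed_of_isClosed isClosed_Icc
      isClosed_singleton) inter_subset_left).exists_isLeast ⟨1, h1, rfl⟩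
  have hMT : M T = M 1 := hMT
  have hmin : minPoint p (γ T) = minPoint p q := by
    have hx := hax hT h1 hT.2
    have hy := hay hT h1 hT.2
    simp only [hM, taxiNorm, minPoint, hγ.2.2.2.2] at hx hy hMT
    exact Prod.ext (ell_congr_of_abs_eq (by linarith)) (ell_congr_of_abs_eq (by linarith))
  refine ⟨T, hT, ?_⟩
  rw [← hmin]
  rcases hT.1.eq_or_lt with hT0 | hT0
  · rw [← hT0, hγ.2.2.2.1, minPoint_self]
  by_contra hne
  have hne' : M T ≠ taxiNorm (γ T) := fun h => hne (minPoint_eq_of_taxiNorm_eq h).symm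
  -- Otherwise `M` has zero derivative shortly before `T`, and `T` is not the first such time.
  have hev : ∀ᶠ t in 𝓝[Icc 0 1] T, M t ≠ taxiNorm (γ t) :=
    ((hcM T hT).sub (hcN T hT)).eventually_ne (sub_ne_zero.2 hne') |>.mono
      fun t ht => sub_ne_zero.1 ht
  obtain ⟨ε, hε, hball⟩ := Metric.mem_nhdsWithin_iff.1 hev
  have hST : max 0 (T - ε / 2) < T := max_lt hT0 (by linarith)
  have hS0 : 0 ≤ max 0 (T - ε / 2) := le_max_left _ _
  have hSε : T - ε / 2 ≤ max 0 (T - ε / 2) := le_max_right _ _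
  generalize max 0 (T - ε / 2) = S at hST hS0 hSε
  have hsub : Icc S T ⊆ Icc 0 1 := Icc_subset_Icc hS0 hT.2
  have hFTC := (hac.mono (by rwa [uIcc_of_le hST.le, hI])).integral_deriv_eq_sub
  have hzero : ∫ t in S..T, deriv M t = 0 := by
    refine intervalIntegral.integral_zero_ae ?_
    filter_upwards [ae_potential hγ, ae_deriv_potential_eq_speed hγ h] with t h2 h3 ht
    rw [uIoc_of_le hST.le] at ht
    have ht' := hsub (Ioc_subset_Icc_self ht)
    by_contra hd
    refine hball ⟨?_, ht'⟩ (congrArg taxiNorm (((h2 ht').2 (h3 ht')).2.2 hd))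
    rw [Metric.mem_ball, Real.dist_eq, abs_lt]
    constructor <;> linarith [ht.1, ht.2]
  have hMS : M S = M 1 := by rw [← hMT]; linarith
  exact absurd (hleast ⟨hsub ⟨le_rfl, hST.le⟩, hMS⟩) hST.not_ge

/-! ### The length of doubly monotonic curves through the minimal point -/

/-- Where both components approach `0`, or both move away from `0`, the speed is the rate of change
of `artanh` of the norm, up to sign. -/
theorem ae_speed_eq (hγ : γ ∈ curves p q) :
    ∀ᵐ t, t ∈ Icc (0 : ℝ) 1 →
      (deriv (fun s => |(γ s).1|) t ≤ 0 → deriv (fun s => |(γ s).2|) t ≤ 0 →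
        speed γ t = -deriv (fun s => Real.artanh (taxiNorm (γ s))) t) ∧
      (0 ≤ deriv (fun s => |(γ s).1|) t → 0 ≤ deriv (fun s => |(γ s).2|) t →
        speed γ t = deriv (fun s => Real.artanh (taxiNorm (γ s))) t) := by
  filter_upwards [ae_differentiableAt_taxiNorm hγ, ae_hasDerivAt_artanh_taxiNorm hγ] with t h hN ht
  obtain ⟨⟨hx, hxa⟩, ⟨hy, hya⟩⟩ := h ht
  have hs : speed γ t = 1 / (1 - taxiNorm (γ t) ^ 2) *
      (|deriv (fun s => |(γ s).1|) t| + |deriv (fun s => |(γ s).2|) t|) := by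
    rw [abs_deriv_abs hx hxa, abs_deriv_abs hy hya, speed, hypNorm, taxiNorm]; ring
  rw [hs, (hN ht).deriv]
  refine ⟨fun h1 h2 => ?_, fun h1 h2 => ?_⟩
  · rw [abs_of_nonpos h1, abs_of_nonpos h2]; ring
  · rw [abs_of_nonneg h1, abs_of_nonneg h2]

theorem length_eq (hγ : γ ∈ curves p q) (hd : DoublyMonotonic γ)
    (hm : PassesThrough γ (minPoint p q)) :
    length γ = potential p q + Real.artanh (taxiNorm p) := by
  obtain ⟨T, hT, hγT⟩ := hm
  obtain ⟨ax, mx⟩ := abs_antitoneOn_monotoneOn hd.1 hT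
    (by simp [hγT, hγ.2.2.2.1, hγ.2.2.2.2, minPoint])
  obtain ⟨ay, my⟩ := abs_antitoneOn_monotoneOn hd.2 hT
    (by simp [hγT, hγ.2.2.2.1, hγ.2.2.2.2, minPoint])
  have hI := uIcc_of_le (zero_le_one' ℝ)
  have hac := absolutelyContinuousOnInterval_artanh_taxiNorm hγ
  have hsub1 : Icc 0 T ⊆ Icc 0 1 := Icc_subset_Icc_right hT.2
  have hsub2 : Icc T 1 ⊆ Icc 0 1 := Icc_subset_Icc_left hT.1
  have e1 : ∫ t in (0 : ℝ)..T, speed γ t =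
      Real.artanh (taxiNorm p) - Real.artanh (taxiNorm (minPoint p q)) := by
    have := (hac.mono (by rwa [uIcc_of_le hT.1, hI])).integral_deriv_eq_sub
    rw [hγT, hγ.2.2.2.1] at this
    rw [← neg_sub, ← this, ← intervalIntegral.integral_neg]
    refine intervalIntegral.integral_congr_ae ?_
    filter_upwards [ae_speed_eq hγ, compl_mem_ae_iff.2 (measure_singleton T)] with t h hne ht
    rw [uIoc_of_le hT.1] at ht
    have hn : Icc 0 T ∈ 𝓝 t := Icc_mem_nhds ht.1 (lt_of_le_of_ne ht.2 hne)
    refine (h (hsub1 (Ioc_subset_Icc_self ht))).1 ?_ ?_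
    · rw [← derivWithin_of_mem_nhds hn]; exact ax.derivWithin_nonpos
    · rw [← derivWithin_of_mem_nhds hn]; exact ay.derivWithin_nonpos
  have e2 : ∫ t in T..1, speed γ t =
      Real.artanh (taxiNorm q) - Real.artanh (taxiNorm (minPoint p q)) := by
    have := (hac.mono (by rwa [uIcc_of_le hT.2, hI])).integral_deriv_eq_sub
    rw [hγT, hγ.2.2.2.2] at this
    rw [← this]
    refine intervalIntegral.integral_congr_ae ?_
    filter_upwards [ae_speed_eq hγ, compl_mem_ae_iff.2 (measure_singleton 1)] with t h hne ht
    rw [uIoc_of_le hT.2] at ht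
    have hn : Icc T 1 ∈ 𝓝 t := Icc_mem_nhds ht.1 (lt_of_le_of_ne ht.2 hne)
    refine (h (hsub2 (Ioc_subset_Icc_self ht))).2 ?_ ?_
    · rw [← derivWithin_of_mem_nhds hn]; exact mx.derivWithin_nonneg
    · rw [← derivWithin_of_mem_nhds hn]; exact my.derivWithin_nonneg
  have hi := intervalIntegrable_speed hγ
  have : length γ = ∫ t in (0 : ℝ)..1, speed γ t := rfl
  rw [this, ← intervalIntegral.integral_add_adjacent_intervals
    (hi.mono_set (by rwa [uIcc_of_le hT.1, hI])) (hi.mono_set (by rwa [uIcc_of_le hT.2, hI])),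
    e1, e2, potential]
  ring

end Curve

/-! ### The L-shaped curve -/

/-- One component of a broken line from `a` through `b` to `c`. -/
noncomputable def brokenLine (a b c t : ℝ) : ℝ :=
  if t ≤ 1 / 2 then a + 2 * t * (b - a) else b + (2 * t - 1) * (c - b)

theorem lCurve_apply (p q : ℝ × ℝ) (t : ℝ) : lCurve p q t =
    (brokenLine p.1 (ell p.1 q.1) q.1 t, brokenLine p.2 (ell p.2 q.2) q.2 t) := by
  unfold lCurve concat segmentCurve brokenLine minPoint
  split_ifs <;> rfl

theorem brokenLine_absolutelyContinuous (a b c : ℝ) :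
    AbsolutelyContinuousOnInterval (brokenLine a b c) 0 1 := by
  refine LipschitzOnWith.absolutelyContinuousOnInterval
    (K := Real.toNNReal (2 * (|b - a| + |c - b|))) ?_
  refine (LipschitzWith.of_dist_le_mul fun s t => ?_).lipschitzOnWith
  rw [Real.coe_toNNReal _ (by positivity), Real.dist_eq, Real.dist_eq]
  have key : brokenLine a b c s - brokenLine a b c t =
      2 * (b - a) * (min s (1 / 2) - min t (1 / 2)) +
      2 * (c - b) * (max s (1 / 2) - max t (1 / 2)) := by
    unfold brokenLine
    split_ifs with h1 h2 h2
    · rw [min_eq_left h1, min_eq_left h2, max_eq_right h1, max_eq_right h2]; ring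
    · rw [min_eq_left h1, min_eq_right (by linarith), max_eq_right h1,
        max_eq_left (by linarith)]; ring
    · rw [min_eq_right (by linarith), min_eq_left h2, max_eq_left (by linarith),
        max_eq_right h2]; ring
    · rw [min_eq_right (by linarith), min_eq_right (by linarith), max_eq_left (by linarith),
        max_eq_left (by linarith)]; ring
  have hmm (r : ℝ) : |min s r - min t r| ≤ |s - t| ∧ |max s r - max t r| ≤ |s - t| := by
    clear key
    grind
  obtain ⟨h1, h2⟩ := hmm (1 / 2)
  rw [key]
  refine (abs_add_le _ _).trans ?_
  rw [abs_mul, abs_mul, abs_mul, abs_mul, abs_two]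
  nlinarith [mul_le_mul_of_nonneg_left h1 (abs_nonneg (b - a)),
    mul_le_mul_of_nonneg_left h2 (abs_nonneg (c - b))]

theorem brokenLine_monotone {a b c : ℝ} (h1 : a ≤ b) (h2 : b ≤ c) :
    MonotoneOn (brokenLine a b c) (Icc 0 1) := by
  intro s hs t ht hst
  unfold brokenLine
  split_ifs with h3 h4 h4
  · nlinarith
  · nlinarith [mul_nonneg (sub_nonneg.2 h3) (sub_nonneg.2 h1),
      mul_nonneg (sub_nonneg.2 (not_le.1 h4).le) (sub_nonneg.2 h2)]
  · linarith
  · nlinarith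

theorem brokenLine_neg (a b c t : ℝ) : brokenLine (-a) (-b) (-c) t = -brokenLine a b c t := by
  unfold brokenLine
  split_ifs <;> ring

theorem brokenLine_monotone_or_antitone (a c : ℝ) :
    MonotoneOn (brokenLine a (ell a c) c) (Icc 0 1) ∨
      AntitoneOn (brokenLine a (ell a c) c) (Icc 0 1) := by
  have h : a ≤ ell a c ∧ ell a c ≤ c ∨ c ≤ ell a c ∧ ell a c ≤ a := by
    rcases le_total 0 a with ha | ha
    · rw [ell_of_nonneg ha]; grind
    · rw [ell_of_nonpos ha]; grind
  refine h.imp (fun h => brokenLine_monotone h.1 h.2) fun h => ?_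
  have := (brokenLine_monotone (neg_le_neg h.2) (neg_le_neg h.1)).neg
  simpa only [brokenLine_neg, neg_neg] using this

theorem abs_brokenLine_le {a b c t : ℝ} (hab : |b| ≤ |a|) (hbc : |b| ≤ |c|)
    (ht : t ∈ Icc (0 : ℝ) 1) :
    |brokenLine a b c t| ≤ if t ≤ 1 / 2 then |a| else |c| := by
  unfold brokenLine
  split_ifs with h
  · calc |a + 2 * t * (b - a)| = |(1 - 2 * t) * a + 2 * t * b| := by ring_nf
      _ ≤ (1 - 2 * t) * |a| + 2 * t * |b| := by
        refine (abs_add_le _ _).trans_eq ?_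
        rw [abs_mul, abs_mul, abs_of_nonneg (show 0 ≤ 1 - 2 * t by linarith),
          abs_of_nonneg (show 0 ≤ 2 * t by linarith [ht.1])]
      _ ≤ |a| := by nlinarith [ht.1]
  · calc |b + (2 * t - 1) * (c - b)| = |(2 - 2 * t) * b + (2 * t - 1) * c| := by ring_nf
      _ ≤ (2 - 2 * t) * |b| + (2 * t - 1) * |c| := by
        refine (abs_add_le _ _).trans_eq ?_
        rw [abs_mul, abs_mul, abs_of_nonneg (show 0 ≤ 2 - 2 * t by linarith [ht.2]),
          abs_of_nonneg (show 0 ≤ 2 * t - 1 by linarith)]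
      _ ≤ |c| := by nlinarith [ht.2]

theorem lCurve_mem_curves {p q : ℝ × ℝ} (hp : p ∈ disk) (hq : q ∈ disk) :
    lCurve p q ∈ curves p q := by
  refine ⟨fun t ht => ?_, ?_, ?_, ?_, ?_⟩
  · have h1 := abs_brokenLine_le (abs_ell_le_left p.1 q.1) (abs_ell_le_right p.1 q.1) ht
    have h2 := abs_brokenLine_le (abs_ell_le_left p.2 q.2) (abs_ell_le_right p.2 q.2) ht
    rw [lCurve_apply]
    simp only [disk, taxiNorm, mem_ofPred_eq] at hp hq ⊢
    split_ifs at h1 h2 <;> linarith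
  · simpa only [lCurve_apply] using brokenLine_absolutelyContinuous _ _ _
  · simpa only [lCurve_apply] using brokenLine_absolutelyContinuous _ _ _
  · simp [lCurve_apply, brokenLine]
  · rw [lCurve_apply]; unfold brokenLine; norm_num

theorem lCurve_doublyMonotonic (p q : ℝ × ℝ) : DoublyMonotonic (lCurve p q) := by
  simp only [DoublyMonotonic, lCurve_apply]
  exact ⟨brokenLine_monotone_or_antitone _ _, brokenLine_monotone_or_antitone _ _⟩

theorem lCurve_passesThrough (p q : ℝ × ℝ) : PassesThrough (lCurve p q) (minPoint p q) :=
  ⟨1 / 2, by norm_num, by rw [lCurve_apply]; simp [brokenLine, minPoint]⟩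

end TaxicabHyp

theorem theoremA (p q : ℝ × ℝ) (hp : p ∈ TaxicabHyp.disk) (hq : q ∈ TaxicabHyp.disk)
    (γ : ℝ → ℝ × ℝ) (hγ : γ ∈ TaxicabHyp.curves p q) :
    TaxicabHyp.length (TaxicabHyp.lCurve p q) ≤ TaxicabHyp.length γ ∧
    (TaxicabHyp.length γ = TaxicabHyp.length (TaxicabHyp.lCurve p q) ↔
      TaxicabHyp.DoublyMonotonic γ ∧
        TaxicabHyp.PassesThrough γ (TaxicabHyp.minPoint p q)) := by
  rw [TaxicabHyp.length_eq (TaxicabHyp.lCurve_mem_curves hp hq)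
    (TaxicabHyp.lCurve_doublyMonotonic p q) (TaxicabHyp.lCurve_passesThrough p q)]
  exact ⟨TaxicabHyp.potential_le_length hγ,
    fun h => ⟨TaxicabHyp.doublyMonotonic_of_length_eq hγ h,
      TaxicabHyp.passesThrough_of_length_eq hγ h⟩,
    fun h => TaxicabHyp.length_eq hγ h.1 h.2⟩
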